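/- Let $d\in\{2,3\}$, let $\mathcal D\subset\mathbb R^d$ be a bounded open polyhedral domain with a conformal mesh made of finitely many $d$-simplices (the elements), and let $\mathrm{Re}\ge 0$, $\mathrm{Wi}>0$, $0\le\varepsilon<1$, $T>0$, $N_T\ge 1$, $\Delta t=T/N_T$, $t^n=n\Delta t$. Let $(\mathbb P_2)^d$ be the space of continuous vector fields on $\overline{\mathcal D}$ that vanish on $\partial\mathcal D$ and whose components are polynomials of degree at most $2$ on each element; $\mathbb P_{1,disc}$ the space of scalar fields that are polynomials of degree at most $1$ in each element, possibly discontinuous across elements; and $(\mathbb P_0)^{d(d+1)/2}$ the space of symmetric $d\times d$ matrix fields that are constant in each element. Write $(\nabla u)_{ij}=\partial_{x_j}u_i$, $(w\cdot\nabla u)_i=\sum_j w_j\partial_{x_j}u_i$, $A:B=\sum_{i,j}A_{ij}B_{ij}$ and $|A|^2=A:A$. Let $(u_h^n,p_h^n,\sigma_h^n)\in(\mathbb P_2)^d\times\mathbb P_{1,disc}\times(\mathbb P_0)^{d(d+1)/2}$, $0\le n\le N_T$, be such that the initial velocity satisfies $\int_{\mathcal D}q\,\mathrm{div}\,u_h^0=0$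 for all $q\in\mathbb P_{1,disc}$, and such that for every $0\le n\le N_T-1$ and every test function $(v,q,\phi)\in(\mathbb P_2)^d\times\mathbb P_{1,disc}\times(\mathbb P_0)^{d(d+1)/2}$, $$ \begin{aligned} 0=\int_{\mathcal D}\;&\mathrm{Re}\Big(\tfrac{u_h^{n+1}-u_h^n}{\Delta t}+u_h^n\cdot\nabla u_h^{n+1}\Big)\cdot v-p_h^{n+1}\,\mathrm{div}\,v+q\,\mathrm{div}\,u_h^{n+1}+(1-\varepsilon)\nabla u_h^{n+1}:\nabla v+\tfrac{\varepsilon}{\mathrm{Wi}}\sigma_h^{n+1}:\nabla v\\ &+\tfrac{\sigma_h^{n+1}-\sigma_h^n\circ X^n(t^n)}{\Delta t}:\phi-\big((\nabla u_h^{n+1})\sigma_h^{n+1}+\sigma_h^{n+1}(\nabla u_h^{n+1})^T\big):\phi+\tfrac1{\mathrm{Wi}}(\sigma_h^{n+1}-I):\phi , \end{aligned} $$ where $X^n(t):\mathcal D\to\mathcal D$, $t\in[t^n,t^{n+1}]$, is the backward flow of $u_h^n$, that is, $\frac{d}{dt}X^n(t,x)=u_h^n(X^n(t,x))$ for $t\in[t^n,t^{n+1}]$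 and $X^n(t^{n+1},x)=x$, for all $x\in\mathcal D$. Suppose that $\sigma_h^n$ is positive definite in every element for every $0\le n\le N_T$. Then the free energy $$ F_h^n=\frac{\mathrm{Re}}2\int_{\mathcal D}|u_h^n|^2+\frac{\varepsilon}{2\mathrm{Wi}}\int_{\mathcal D}\mathrm{tr}\big(\sigma_h^n-\ln\sigma_h^n-I\big) $$ satisfies, for all $0\le n\le N_T-1$, $$ F_h^{n+1}-F_h^n+\int_{\mathcal D}\frac{\mathrm{Re}}2|u_h^{n+1}-u_h^n|^2+\Delta t\int_{\mathcal D}\Big((1-\varepsilon)|\nabla u_h^{n+1}|^2+\frac{\varepsilon}{2\mathrm{Wi}^2}\mathrm{tr}\big(\sigma_h^{n+1}+(\sigma_h^{n+1})^{-1}-2I\big)\Big)\le 0 . $$ In particular, the sequence $(F_h^n)_{0\le n\le N_T}$ is non-increasing. -/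

import Mathlib

open MeasureTheory Set

/-- The space `ℝ^d` with its Euclidean norm and Lebesgue measure. -/
abbrev Spc (d : ℕ) : Type := EuclideanSpace ℝ (Fin d)

noncomputable section

namespace OldroydB

variable {d : ℕ}

/-- Velocity gradient, with the convention `(∇u)_{ij} = ∂u_i/∂x_j`. It is used for continuous,
elementwise polynomial fields, for which it is the classical gradient inside every element. -/
def grad (u : Spc d → Spc d) (x : Spc d) : Matrix (Fin d) (Fin d) ℝ :=
  Matrix.of fun i j => fderiv ℝ u x (EuclideanSpace.single j 1) i

/-- Divergence `∑ i, ∂u_i/∂x_i`. -/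
def dvg (u : Spc d → Spc d) (x : Spc d) : ℝ := (grad u x).trace

/-- The advection term `(w · ∇)u`, whose `i`-th component is `∑ j, w_j ∂u_i/∂x_j`. -/
def advect (w u : Spc d → Spc d) (x : Spc d) : Spc d :=
  WithLp.toLp 2 fun i => ∑ j, w x j * grad u x i j

/-- Double contraction `A : B = ∑ i j, A_ij B_ij`. -/
def dcontr (A B : Matrix (Fin d) (Fin d) ℝ) : ℝ := ∑ i, ∑ j, A i j * B i j

/-- Logarithm of a symmetric positive definite matrix, i.e. the logarithm applied to the
eigenvalues in an orthogonal diagonalisation. -/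
def matLog (A : Matrix (Fin d) (Fin d) ℝ) : Matrix (Fin d) (Fin d) ℝ := cfc Real.log A

/-- The elements of a simplicial complex in `ℝ^d`, given by their sets of `d + 1` vertices. -/
def cells (M : Geometry.SimplicialComplex ℝ (Spc d)) : Set (Finset (Spc d)) :=
  {s | s ∈ M.faces ∧ s.card = d + 1}

/-- The closed simplex with vertex set `s`. -/
def elt (s : Finset (Spc d)) : Set (Spc d) := convexHull ℝ (s : Set (Spc d))

/-- `M` is a finite conformal simplicial mesh of the polyhedral domain `D`: the elements tile the
closure of `D` and have their interiors in `D`. (Conformity, i.e. that two elements meet in a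
common face or not at all, is part of the notion of a simplicial complex.) -/
structure IsMesh (D : Set (Spc d)) (M : Geometry.SimplicialComplex ℝ (Spc d)) : Prop where
  isOpen : IsOpen D
  finite : (cells M).Finite
  cover : closure D = ⋃ s ∈ cells M, elt s
  interior_subset : ∀ s ∈ cells M, interior (elt s) ⊆ D

/-- On the set `S` the function `f` is a polynomial of total degree at most `k`. -/
def IsPolyOn (k : ℕ) (f : Spc d → ℝ) (S : Set (Spc d)) : Prop :=
  ∃ P : MvPolynomial (Fin d) ℝ, P.totalDegree ≤ k ∧
    ∀ x ∈ S, f x = MvPolynomial.eval (fun i => x i) P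

/-- The velocity space `(ℙ₂)^d`: continuous vector fields on the closure of `D` that vanish on the
boundary and whose components are polynomials of degree at most 2 on every element. -/
structure IsP2 (D : Set (Spc d)) (M : Geometry.SimplicialComplex ℝ (Spc d))
    (u : Spc d → Spc d) : Prop where
  continuousOn : ContinuousOn u (closure D)
  boundary : ∀ x ∈ frontier D, u x = 0
  poly : ∀ s ∈ cells M, ∀ i, IsPolyOn 2 (fun x => u x i) (elt s)

/-- The pressure space `ℙ_{1,disc}`: polynomials of degree at most 1 inside every element. The
values on the interfaces, a null set, are immaterial. -/
def IsP1disc (M : Geometry.SimplicialComplex ℝ (Spc d)) (p : Spc d → ℝ) : Prop :=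
  ∀ s ∈ cells M, IsPolyOn 1 p (interior (elt s))

/-- The stress space `(ℙ₀)^{d(d+1)/2}`: symmetric matrix fields that are constant inside every
element. The values on the interfaces, a null set, are immaterial. -/
def IsP0sym (M : Geometry.SimplicialComplex ℝ (Spc d))
    (σ : Spc d → Matrix (Fin d) (Fin d) ℝ) : Prop :=
  ∀ s ∈ cells M, ∃ A : Matrix (Fin d) (Fin d) ℝ, A.IsSymm ∧ ∀ x ∈ interior (elt s), σ x = A

/-- A field of `(ℙ₀)^{d(d+1)/2}` is positive definite, i.e. it is so on every element. -/
def IsPosDefField (M : Geometry.SimplicialComplex ℝ (Spc d))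
    (σ : Spc d → Matrix (Fin d) (Fin d) ℝ) : Prop :=
  ∀ s ∈ cells M, ∀ x ∈ interior (elt s), (σ x).PosDef

/-- `X t : D → D`, for `t ∈ [a, b]`, is the backward flow of the velocity field `u`:
`d/dt X(t,x) = u (X(t,x))` on `[a, b]` and `X(b,x) = x`. -/
structure IsBackwardFlow (D : Set (Spc d)) (u : Spc d → Spc d) (a b : ℝ)
    (X : ℝ → Spc d → Spc d) : Prop where
  mem : ∀ x ∈ D, ∀ t ∈ Icc a b, X t x ∈ D
  deriv : ∀ x ∈ D, ∀ t ∈ Icc a b,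
    HasDerivWithinAt (fun r => X r x) (u (X t x)) (Icc a b) t
  final : ∀ x ∈ D, X b x = x

/-- The variational form of one time step of length `Δt`, evaluated at the test function
`(v, q, φ)`. Here `u₀`, `σ₀` are the velocity and the conformation tensor at the old time, `u`, `p`,
`σ` the unknowns at the new time, and `Y` maps a point to the foot of its characteristic. -/
def stepForm (D : Set (Spc d)) (Re Wi ε Δt : ℝ)
    (u₀ : Spc d → Spc d) (σ₀ : Spc d → Matrix (Fin d) (Fin d) ℝ) (Y : Spc d → Spc d)
    (u : Spc d → Spc d) (p : Spc d → ℝ) (σ : Spc d → Matrix (Fin d) (Fin d) ℝ)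
    (v : Spc d → Spc d) (q : Spc d → ℝ) (φ : Spc d → Matrix (Fin d) (Fin d) ℝ) : ℝ :=
  ∫ x in D,
    (Re * inner ℝ (Δt⁻¹ • (u x - u₀ x) + advect u₀ u x) (v x)
      - p x * dvg v x + q x * dvg u x
      + (1 - ε) * dcontr (grad u x) (grad v x)
      + ε / Wi * dcontr (σ x) (grad v x)
      + dcontr (Δt⁻¹ • (σ x - σ₀ (Y x))) (φ x)
      - dcontr (grad u x * σ x + σ x * (grad u x).transpose) (φ x)
      + 1 / Wi * dcontr (σ x - 1) (φ x))

/-- `(u n, p n, σ n)`, `0 ≤ n ≤ N`, solves the scheme with the characteristic method on the mesh `M`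
of `D`, with time step `T / N` and `X n` the backward flow of `u n` on `[t^n, t^{n+1}]`. -/
structure IsSolution (D : Set (Spc d)) (M : Geometry.SimplicialComplex ℝ (Spc d))
    (Re Wi ε T : ℝ) (N : ℕ)
    (u : ℕ → Spc d → Spc d) (p : ℕ → Spc d → ℝ)
    (σ : ℕ → Spc d → Matrix (Fin d) (Fin d) ℝ) (X : ℕ → ℝ → Spc d → Spc d) : Prop where
  velocity : ∀ n ≤ N, IsP2 D M (u n)
  pressure : ∀ n ≤ N, IsP1disc M (p n)
  stress : ∀ n ≤ N, IsP0sym M (σ n)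
  flow : ∀ n < N, IsBackwardFlow D (u n) (n * (T / N)) ((n + 1) * (T / N)) (X n)
  step : ∀ n < N, ∀ v q φ, IsP2 D M v → IsP1disc M q → IsP0sym M φ →
    stepForm D Re Wi ε (T / N) (u n) (σ n) (X n (n * (T / N)))
      (u (n + 1)) (p (n + 1)) (σ (n + 1)) v q φ = 0

/-- The free energy `F(u, σ) = Re/2 ∫_D |u|² + ε/(2 Wi) ∫_D tr(σ - ln σ - I)`. -/
def freeEnergy (D : Set (Spc d)) (Re Wi ε : ℝ) (u : Spc d → Spc d)
    (σ : Spc d → Matrix (Fin d) (Fin d) ℝ) : ℝ :=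
  Re / 2 * (∫ x in D, ‖u x‖ ^ 2)
    + ε / (2 * Wi) * (∫ x in D, (σ x - matLog (σ x) - 1).trace)

end OldroydB

end

/-! ### Positive definite matrices -/

section PosDef

open Matrix
open scoped MatrixOrder

variable {n : Type*} [Fintype n] [DecidableEq n]

/-! The scheme is tested with `v = u^{n+1}`, `q = p^{n+1}` and `φ = ε/(2Wi) (I - (σ^{n+1})⁻¹)`; this
`φ` is admissible because inverting a piecewise constant field keeps it piecewise constant. The
pressure terms cancel, the stretching term cancels the polymer stress up to a multiple of the
divergence, relaxation gives the stress dissipation, and polarisation gives the kinetic energy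
increment plus `Re/2 |u^{n+1} - u^n|²`.

Three facts remain. Divergences of velocities lie in the pressure space, so weak incompressibility
is incompressibility almost everywhere (`IsP2.ae_dvg_eq_zero`). Hence advection contributes nothing:
`2 (w·∇u)·u = w·∇|u|²` integrates to zero (`integral_inner_advect_self`). Finally, concavity of `log
det` bounds the stress increment below by the entropy of `σ^{n+1}` minus that of `σ^n ∘ X^n`
(`entropy_sub_le_dcontr`), and the latter integrates to the entropy of `σ^n` because the backward
flow preserves volume.

The velocity is only Lipschitz, so volume preservation is proved without Jacobians: for Lipschitz
`g`, the time derivative of `∫ g ∘ Φ_s` is `∫ D(g ∘ Φ_s)(v)`, which vanishes by integration by parts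
(`IsForwardFlow.measurePreserving`). -/

theorem Matrix.PosDef.trace_cfc_log {A : Matrix n n ℝ} (hA : A.PosDef) :
    (cfc Real.log A).trace = Real.log A.det := by
  have hH : A.IsHermitian := hA.1
  rw [hH.cfc_eq, Matrix.IsHermitian.cfc, Unitary.conjStarAlgAut_apply, trace_mul_cycle,
    Unitary.coe_star_mul_self, one_mul, trace_diagonal, hH.det_eq_prod_eigenvalues]
  simp only [Function.comp_apply, RCLike.ofReal_real_eq_id, id]
  rw [Real.log_prod]
  exact fun i _ => (hA.eigenvalues_pos i).ne'

theorem Matrix.PosDef.log_det_le_trace_sub_card {A : Matrix n n ℝ} (hA : A.PosDef) :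
    Real.log A.det ≤ A.trace - Fintype.card n := by
  have hH : A.IsHermitian := hA.1
  rw [hH.det_eq_prod_eigenvalues, hH.trace_eq_sum_eigenvalues]
  simp only [RCLike.ofReal_real_eq_id, id]
  rw [Real.log_prod fun i _ => (hA.eigenvalues_pos i).ne']
  calc ∑ i, Real.log (hH.eigenvalues i) ≤ ∑ i, (hH.eigenvalues i - 1) :=
        Finset.sum_le_sum fun i _ => Real.log_le_sub_one_of_pos (hA.eigenvalues_pos i)
    _ = _ := by simp [Finset.sum_sub_distrib]

/-- Tangent-plane inequality for the concave function `log det` at `B`. A congruence reduces it to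
`B = 1`, where it is `log λ ≤ λ - 1` summed over eigenvalues. -/
theorem Matrix.PosDef.log_det_sub_log_det_le {A B : Matrix n n ℝ} (hA : A.PosDef)
    (hB : B.PosDef) :
    Real.log A.det - Real.log B.det ≤ (A * B⁻¹).trace - Fintype.card n := by
  -- With `B⁻¹ = Cᴴ C`, the matrix `C A Cᴴ` is positive definite, with determinant `det A / det B`
  -- and trace `tr (A B⁻¹)`.
  obtain ⟨C, hC⟩ := (CStarAlgebra.nonneg_iff_eq_star_mul_self (a := B⁻¹)).1 hB.inv.posSemidef.nonneg
  rw [star_eq_conjTranspose] at hC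
  have hdet : C.det * C.det = B.det⁻¹ := by
    have := congrArg Matrix.det hC
    rw [det_mul, det_conjTranspose, star_trivial, det_nonsing_inv, Ring.inverse_eq_inv'] at this
    exact this.symm
  have hC0 : C.det ≠ 0 := fun h => by
    rw [h, zero_mul] at hdet
    exact (inv_ne_zero hB.det_pos.ne') hdet.symm
  have hP : (C * A * Cᴴ).PosDef :=
    hA.mul_mul_conjTranspose_same
      (Matrix.vecMul_injective_iff_isUnit.2 ((Matrix.isUnit_iff_isUnit_det C).2 hC0.isUnit))
  have h := hP.log_det_le_trace_sub_card
  have h1 : (C * A * Cᴴ).det = A.det * B.det⁻¹ := by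
    rw [det_mul, det_mul, det_conjTranspose, star_trivial, ← hdet]; ring
  rw [h1, Matrix.trace_mul_cycle, ← hC, Real.log_mul hA.det_pos.ne'
    (inv_ne_zero hB.det_pos.ne'), Real.log_inv, Matrix.trace_mul_comm] at h
  linarith

/-- The bound on `log det` is added for `A` and `A⁻¹`; the logarithms cancel. -/
theorem Matrix.PosDef.trace_add_inv_sub_two_nonneg {A : Matrix n n ℝ} (hA : A.PosDef) :
    0 ≤ (A + A⁻¹ - (2 : ℝ) • (1 : Matrix n n ℝ)).trace := by
  have h1 := hA.log_det_le_trace_sub_card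
  have h2 := hA.inv.log_det_le_trace_sub_card
  rw [det_nonsing_inv, Ring.inverse_eq_inv', Real.log_inv] at h2
  rw [trace_sub, trace_add, trace_smul, trace_one, smul_eq_mul]
  linarith

end PosDef

/-! ### Polynomial functions on `ℝ^d` -/

theorem MvPolynomial.totalDegree_pderiv_le {R ι : Type*} [CommSemiring R] (i : ι)
    (P : MvPolynomial ι R) : (pderiv i P).totalDegree ≤ P.totalDegree - 1 := by
  refine Finset.sup_le fun m hm => ?_
  have h : m + Finsupp.single i 1 ∈ P.support := by
    rw [mem_support_iff, coeff_pderiv] at hm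
    exact mem_support_iff.2 (left_ne_zero_of_mul hm)
  have h' := le_totalDegree h
  rw [Finsupp.sum_add_index' (fun _ => rfl) (fun _ _ _ => rfl),
    Finsupp.sum_single_index rfl] at h'
  omega

namespace OldroydB

variable {d : ℕ}

/-- The function on `ℝ^d` defined by a polynomial in `d` variables. -/
noncomputable abbrev polyFun (P : MvPolynomial (Fin d) ℝ) (x : Spc d) : ℝ :=
  MvPolynomial.eval (fun i => x i) P

theorem polyFun_C (a : ℝ) : polyFun (d := d) (MvPolynomial.C a) = fun _ => a := by
  ext; simp [polyFun]

theorem polyFun_add (P Q : MvPolynomial (Fin d) ℝ) :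
    polyFun (P + Q) = fun x => polyFun P x + polyFun Q x := by
  ext; simp [polyFun]

theorem polyFun_mul_X (P : MvPolynomial (Fin d) ℝ) (i : Fin d) :
    polyFun (P * MvPolynomial.X i) =
      fun x => polyFun P x * EuclideanSpace.proj (𝕜 := ℝ) i x := by
  ext; simp [polyFun]

theorem contDiff_polyFun (P : MvPolynomial (Fin d) ℝ) {k : WithTop ℕ∞} :
    ContDiff ℝ k (polyFun P) := by
  induction P using MvPolynomial.induction_on with
  | C a => rw [polyFun_C]; exact contDiff_const
  | add p q hp hq => rw [polyFun_add]; exact hp.add hq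
  | mul_X p i hp => rw [polyFun_mul_X]; exact hp.mul (EuclideanSpace.proj (𝕜 := ℝ) i).contDiff

theorem fderiv_polyFun_single (P : MvPolynomial (Fin d) ℝ) (x : Spc d) (j : Fin d) :
    fderiv ℝ (polyFun P) x (EuclideanSpace.single j 1) = polyFun (MvPolynomial.pderiv j P) x := by
  have hd (Q : MvPolynomial (Fin d) ℝ) : DifferentiableAt ℝ (polyFun Q) x :=
    (contDiff_polyFun (k := 1) Q).differentiable one_ne_zero x
  induction P using MvPolynomial.induction_on with
  | C a => simp [polyFun_C, polyFun]
  | add p q hp hq =>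
    rw [polyFun_add, fderiv_fun_add (hd p) (hd q)]
    simp only [_root_.add_apply, hp, hq]
    simp [polyFun]
  | mul_X p i hp =>
    rw [polyFun_mul_X, fderiv_fun_mul (hd p) (EuclideanSpace.proj (𝕜 := ℝ) i).differentiableAt,
      ContinuousLinearMap.fderiv]
    simp only [_root_.add_apply, _root_.smul_apply, hp]
    by_cases h : i = j
    · subst h; simp [polyFun]
    · simp [polyFun, MvPolynomial.pderiv_X_of_ne h, h]

end OldroydB

/-! ### Lipschitz functions on a finite closed cover -/

/-- Follow the piece containing `a` up to its last point `t` in the interval. The other pieces cover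
`(t, b]`, hence `[t, b]` since their union is closed, and induction on the number of pieces applies.
-/
theorem dist_le_of_finite_closed_cover_Icc {F ι : Type*} [PseudoMetricSpace F] [DecidableEq ι]
    {C : ℝ} {K : ι → Set ℝ} {g : ℝ → F} {b : ℝ} (hK : ∀ i, IsClosed (K i))
    (hg : ∀ i, ∀ x ∈ K i, ∀ y ∈ K i, dist (g x) (g y) ≤ C * |x - y|) (I : Finset ι) :
    ∀ a ≤ b, Icc a b ⊆ ⋃ i ∈ I, K i → dist (g a) (g b) ≤ C * (b - a) := by
  induction I using Finset.strongInduction with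
  | H I ih =>
  intro a hab hcov
  obtain ⟨i, hi, hai⟩ : ∃ i ∈ I, a ∈ K i := by simpa using hcov (left_mem_Icc.2 hab)
  have hcpt : IsCompact (Icc a b ∩ K i) := isCompact_Icc.inter_right (hK i)
  have hne : (Icc a b ∩ K i).Nonempty := ⟨a, left_mem_Icc.2 hab, hai⟩
  obtain ⟨t, ⟨⟨hat, htb⟩, hti⟩, htmax⟩ := hcpt.exists_isGreatest hne
  have h1 : dist (g a) (g t) ≤ C * (t - a) := by
    have := hg i a hai t hti
    rwa [abs_sub_comm, abs_of_nonneg (sub_nonneg.2 hat)] at this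
  rcases htb.eq_or_lt with rfl | htb'
  · exact h1
  have h2 : dist (g t) (g b) ≤ C * (b - t) := by
    refine ih (I.erase i) (Finset.erase_ssubset hi) t htb ?_
    have hcl : IsClosed (⋃ j ∈ I.erase i, K j) :=
      Set.Finite.isClosed_biUnion (I.erase i).finite_toSet fun j _ => hK j
    rw [← closure_Ioc htb'.ne]
    refine closure_minimal (fun x hx => ?_) hcl
    obtain ⟨j, hj, hxj⟩ : ∃ j ∈ I, x ∈ K j := by
      simpa using hcov ⟨hat.trans hx.1.le, hx.2⟩
    have hji : j ≠ i := by
      rintro rfl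
      exact absurd (htmax ⟨⟨hat.trans hx.1.le, hx.2⟩, hxj⟩) (not_le.2 hx.1)
    simp only [mem_iUnion]
    exact ⟨j, Finset.mem_erase.2 ⟨hji, hj⟩, hxj⟩
  calc dist (g a) (g b) ≤ dist (g a) (g t) + dist (g t) (g b) := dist_triangle _ _ _
    _ ≤ C * (t - a) + C * (b - t) := add_le_add h1 h2
    _ = C * (b - a) := by ring

theorem lipschitzWith_of_finite_closed_cover {E F ι : Type*} [NormedAddCommGroup E]
    [NormedSpace ℝ E] [PseudoMetricSpace F] [Finite ι] {C : NNReal} {K : ι → Set E} {f : E → F}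
    (hK : ∀ i, IsClosed (K i)) (hcov : ⋃ i, K i = univ) (hf : ∀ i, LipschitzOnWith C f (K i)) :
    LipschitzWith C f := by
  classical
  have := Fintype.ofFinite ι
  refine LipschitzWith.of_dist_le_mul fun x y => ?_
  have hγ : Continuous (AffineMap.lineMap x y : ℝ → E) := AffineMap.lineMap_continuous
  have h := dist_le_of_finite_closed_cover_Icc (C := C * dist x y)
    (K := fun i => AffineMap.lineMap (k := ℝ) x y ⁻¹' K i)
    (g := fun t => f (AffineMap.lineMap x y t)) (b := 1) (fun i => (hK i).preimage hγ)
    (fun i s hs t ht => by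
      have := (hf i).dist_le_mul _ hs _ ht
      rw [dist_lineMap_lineMap, Real.dist_eq] at this
      linarith) Finset.univ 0 zero_le_one
    (by
      intro t _
      have : AffineMap.lineMap x y t ∈ ⋃ i, K i := hcov ▸ mem_univ _
      simpa using this)
  simpa only [AffineMap.lineMap_apply_zero, AffineMap.lineMap_apply_one, sub_zero, mul_one]
    using h

namespace OldroydB

variable {d : ℕ}

/-! ### The mesh -/

theorem isCompact_elt (s : Finset (Spc d)) : IsCompact (elt s) :=
  s.finite_toSet.isCompact_convexHull ℝ

theorem convex_elt (s : Finset (Spc d)) : Convex ℝ (elt s) := convex_convexHull ℝ _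

/-- The union of the open elements. -/
def openCells (M : Geometry.SimplicialComplex ℝ (Spc d)) : Set (Spc d) :=
  ⋃ s ∈ cells M, interior (elt s)

namespace IsMesh

variable {D : Set (Spc d)} {M : Geometry.SimplicialComplex ℝ (Spc d)}

theorem isCompact_closure (hM : IsMesh D M) : IsCompact (closure D) := by
  rw [hM.cover]
  exact hM.finite.isCompact_biUnion fun s _ => isCompact_elt s

theorem volume_lt_top (hM : IsMesh D M) : volume D < ⊤ :=
  (measure_mono subset_closure).trans_lt hM.isCompact_closure.measure_lt_top

theorem openCells_subset (hM : IsMesh D M) : openCells M ⊆ D :=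
  iUnion₂_subset hM.interior_subset

theorem elt_subset (hM : IsMesh D M) {s : Finset (Spc d)} (hs : s ∈ cells M) :
    elt s ⊆ closure D := by
  rw [hM.cover]
  exact subset_biUnion_of_mem hs

/-- The points left out lie on the frontiers of finitely many convex sets, which are null. -/
theorem volume_closure_diff_openCells (hM : IsMesh D M) :
    volume (closure D \ openCells M) = 0 := by
  have h : closure D \ openCells M ⊆ ⋃ s ∈ cells M, frontier (elt s) := by
    rintro x ⟨hx, hx'⟩
    rw [hM.cover] at hx
    simp only [openCells, mem_iUnion, not_exists] at hx hx' ⊢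
    obtain ⟨s, hs, hxs⟩ := hx
    exact ⟨s, hs, subset_closure hxs, hx' s hs⟩
  refine measure_mono_null h ((measure_biUnion_null_iff hM.finite.countable).2 fun s _ => ?_)
  exact (convex_elt s).addHaar_frontier volume

theorem ae_mem_openCells (hM : IsMesh D M) : ∀ᵐ x ∂volume.restrict D, x ∈ openCells M := by
  rw [ae_restrict_iff' hM.isOpen.measurableSet, ae_iff]
  refine measure_mono_null (fun x hx => ?_) hM.volume_closure_diff_openCells
  simp only [mem_ofPred_eq, Classical.not_imp] at hx
  exact ⟨subset_closure hx.1, hx.2⟩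

theorem ae_of_forall_cells (hM : IsMesh D M) {P : Spc d → Prop}
    (h : ∀ s ∈ cells M, ∀ x ∈ interior (elt s), P x) : ∀ᵐ x ∂volume.restrict D, P x := by
  filter_upwards [hM.ae_mem_openCells] with x hx
  simp only [openCells, mem_iUnion] at hx
  obtain ⟨s, hs, hx⟩ := hx
  exact h s hs x hx

theorem restrict_eq (hM : IsMesh D M) : volume.restrict D = volume.restrict (openCells M) := by
  refine Measure.restrict_congr_set ?_
  refine Filter.EventuallyLE.antisymm ?_ hM.openCells_subset.eventuallyLE
  have := (ae_restrict_iff' hM.isOpen.measurableSet).1 hM.ae_mem_openCells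
  exact this

/-- A function which vanishes outside the domain and is `C¹` on every closed element is
globally Lipschitz. -/
theorem exists_lipschitzWith {F : Type*} [NormedAddCommGroup F] [NormedSpace ℝ F]
    (hM : IsMesh D M) {f : Spc d → F} (h0 : ∀ x, x ∉ D → f x = 0)
    (h : ∀ s ∈ cells M, ∃ g, ContDiff ℝ 1 g ∧ EqOn f g (elt s)) :
    ∃ C, LipschitzWith C f := by
  have hC : ∀ s : cells M, ∃ C, LipschitzOnWith C f (elt s.1) := by
    rintro ⟨s, hs⟩
    obtain ⟨g, hg, hfg⟩ := h s hs
    obtain ⟨C, hC⟩ := hg.contDiffOn.exists_lipschitzOnWith one_ne_zero (convex_elt s)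
      (isCompact_elt s)
    exact ⟨C, fun x hx y hy => by rw [hfg hx, hfg hy]; exact hC hx hy⟩
  choose C hC using hC
  have := hM.finite.to_subtype
  have := Fintype.ofFinite (cells M)
  -- The complement of `D`, where `f` vanishes, is the extra piece `none`, so that the closed cover
  -- exhausts the whole space.
  refine ⟨∑ s, C s, lipschitzWith_of_finite_closed_cover
    (K := fun o : Option (cells M) => o.elim Dᶜ fun s => elt s.1) ?_ ?_ ?_⟩
  · rintro (_ | s)
    · exact hM.isOpen.isClosed_compl
    · exact (isCompact_elt s.1).isClosed
  · refine eq_univ_of_forall fun x => ?_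
    by_cases hx : x ∈ D
    · have : x ∈ closure D := subset_closure hx
      rw [hM.cover] at this
      simp only [mem_iUnion] at this ⊢
      obtain ⟨s, hs, hxs⟩ := this
      exact ⟨some ⟨s, hs⟩, hxs⟩
    · exact mem_iUnion.2 ⟨none, hx⟩
  · rintro (_ | s)
    · intro x hx y hy
      rw [h0 x hx, h0 y hy]; simp
    · exact (hC s).weaken (Finset.single_le_sum (fun _ _ => zero_le) (Finset.mem_univ s))

end IsMesh

/-! ### Piecewise continuous functions -/

/-- Inside every element `f` coincides with a function that is continuous on the whole space. -/
def IsPwCont {F : Type*} [TopologicalSpace F] (M : Geometry.SimplicialComplex ℝ (Spc d))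
    (f : Spc d → F) : Prop :=
  ∀ s ∈ cells M, ∃ g : Spc d → F, Continuous g ∧ EqOn f g (interior (elt s))

namespace IsPwCont

variable {D : Set (Spc d)} {M : Geometry.SimplicialComplex ℝ (Spc d)}

theorem comp {F G : Type*} [TopologicalSpace F] [TopologicalSpace G] {f : Spc d → F}
    (hf : IsPwCont M f) {h : F → G} (hh : Continuous h) : IsPwCont M fun x => h (f x) := by
  intro s hs
  obtain ⟨g, hg, hfg⟩ := hf s hs
  exact ⟨fun x => h (g x), hh.comp hg, fun x hx => by simp only [hfg hx]⟩

theorem prodMk {F G : Type*} [TopologicalSpace F] [TopologicalSpace G] {f : Spc d → F}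
    {f' : Spc d → G} (hf : IsPwCont M f) (hf' : IsPwCont M f') :
    IsPwCont M fun x => (f x, f' x) := by
  intro s hs
  obtain ⟨g, hg, hfg⟩ := hf s hs
  obtain ⟨g', hg', hfg'⟩ := hf' s hs
  exact ⟨fun x => (g x, g' x), hg.prodMk hg', fun x hx => by simp only [hfg hx, hfg' hx]⟩

theorem comp₂ {F G H : Type*} [TopologicalSpace F] [TopologicalSpace G] [TopologicalSpace H]
    {f : Spc d → F} {f' : Spc d → G} (hf : IsPwCont M f) (hf' : IsPwCont M f') {h : F → G → H}
    (hh : Continuous fun z : F × G => h z.1 z.2) : IsPwCont M fun x => h (f x) (f' x) :=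
  (hf.prodMk hf').comp hh

theorem integrable {f : Spc d → ℝ} (hf : IsPwCont M f) (hM : IsMesh D M) :
    Integrable f (volume.restrict D) := by
  rw [hM.restrict_eq]
  refine (integrableOn_finite_biUnion hM.finite).2 fun s hs => ?_
  obtain ⟨g, hg, hfg⟩ := hf s hs
  have : IntegrableOn g (interior (elt s)) :=
    (hg.continuousOn.integrableOn_compact (isCompact_elt s)).mono_set interior_subset
  exact this.congr_fun hfg.symm isOpen_interior.measurableSet

end IsPwCont

/-! ### The finite element spaces -/

/-- The vector field whose components are the given polynomials. -/
noncomputable def vecPoly (P : Fin d → MvPolynomial (Fin d) ℝ) (x : Spc d) : Spc d :=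
  WithLp.toLp 2 fun i => polyFun (P i) x

theorem contDiff_vecPoly (P : Fin d → MvPolynomial (Fin d) ℝ) {k : WithTop ℕ∞} :
    ContDiff ℝ k (vecPoly P) :=
  contDiff_euclidean.2 fun i => contDiff_polyFun (P i)

theorem fderiv_apply_coord {u : Spc d → Spc d} {x : Spc d} (hu : DifferentiableAt ℝ u x)
    (v : Spc d) (i : Fin d) : fderiv ℝ u x v i = fderiv ℝ (fun y => u y i) x v := by
  have h := (EuclideanSpace.proj (𝕜 := ℝ) i).hasFDerivAt.comp x hu.hasFDerivAt
  have h' : HasFDerivAt (fun y => u y i) ((EuclideanSpace.proj (𝕜 := ℝ) i).comp (fderiv ℝ u x)) x :=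
    h
  rw [h'.fderiv]; rfl

theorem grad_vecPoly (P : Fin d → MvPolynomial (Fin d) ℝ) (x : Spc d) :
    grad (vecPoly P) x = Matrix.of fun i j => polyFun (MvPolynomial.pderiv j (P i)) x := by
  ext i j
  have h := (contDiff_vecPoly (k := 1) P).differentiable one_ne_zero x
  simp only [grad, Matrix.of_apply]
  rw [fderiv_apply_coord h, ← fderiv_polyFun_single]
  rfl

theorem grad_congr {u v : Spc d → Spc d} {S : Set (Spc d)} (h : EqOn u v S) {x : Spc d}
    (hx : x ∈ interior S) : grad u x = grad v x := by
  have : u =ᶠ[nhds x] v := Filter.eventuallyEq_of_mem (mem_interior_iff_mem_nhds.1 hx) h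
  simp only [grad, this.fderiv_eq]

namespace IsP2

variable {D : Set (Spc d)} {M : Geometry.SimplicialComplex ℝ (Spc d)} {u : Spc d → Spc d}

theorem exists_vecPoly (hu : IsP2 D M u) {s : Finset (Spc d)} (hs : s ∈ cells M) :
    ∃ P : Fin d → MvPolynomial (Fin d) ℝ, (∀ i, (P i).totalDegree ≤ 2) ∧
      EqOn u (vecPoly P) (elt s) := by
  choose P hP hu' using hu.poly s hs
  exact ⟨P, hP, fun x hx => by ext i; exact hu' i x hx⟩

theorem grad_eq {s : Finset (Spc d)} {P : Fin d → MvPolynomial (Fin d) ℝ}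
    (h : EqOn u (vecPoly P) (elt s)) {x : Spc d} (hx : x ∈ interior (elt s)) :
    grad u x = Matrix.of fun i j => polyFun (MvPolynomial.pderiv j (P i)) x := by
  rw [grad_congr h hx, grad_vecPoly]

theorem isPwCont (hu : IsP2 D M u) : IsPwCont M u := by
  intro s hs
  obtain ⟨P, -, h⟩ := hu.exists_vecPoly hs
  exact ⟨vecPoly P, (contDiff_vecPoly (k := 0) P).continuous, h.mono interior_subset⟩

theorem isPwCont_grad (hu : IsP2 D M u) : IsPwCont M (grad u) := by
  intro s hs
  obtain ⟨P, -, h⟩ := hu.exists_vecPoly hs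
  refine ⟨_, ?_, fun x hx => grad_eq h hx⟩
  exact continuous_matrix fun i j => (contDiff_polyFun (k := 0) _).continuous

/-- This compatibility of the two spaces lets the divergence be used as its own pressure test
function. -/
theorem isP1disc_dvg (hu : IsP2 D M u) : IsP1disc M (dvg u) := by
  intro s hs
  obtain ⟨P, hP, h⟩ := hu.exists_vecPoly hs
  refine ⟨∑ i, MvPolynomial.pderiv i (P i), ?_, fun x hx => ?_⟩
  · refine MvPolynomial.totalDegree_finsetSum_le fun i _ => ?_
    have := MvPolynomial.totalDegree_pderiv_le i (P i)
    have := hP i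
    omega
  · rw [dvg, grad_eq h hx]
    simp [Matrix.trace, polyFun]

theorem isPwCont_dvg (hu : IsP2 D M u) : IsPwCont M (dvg u) :=
  hu.isPwCont_grad.comp (continuous_id.matrix_trace)

theorem differentiableAt (hu : IsP2 D M u) {x : Spc d} (hx : x ∈ openCells M) :
    DifferentiableAt ℝ u x := by
  simp only [openCells, mem_iUnion] at hx
  obtain ⟨s, hs, hx⟩ := hx
  obtain ⟨P, -, h⟩ := hu.exists_vecPoly hs
  refine ((contDiff_vecPoly (k := 1) P).differentiable one_ne_zero x).congr_of_eventuallyEq ?_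
  exact Filter.eventuallyEq_of_mem (mem_interior_iff_mem_nhds.1 hx) h

/-- The boundary condition makes extension by zero agree with the polynomial on each whole closed
element, whence its global Lipschitz continuity. -/
theorem indicator_eq (hu : IsP2 D M u) {x : Spc d} (hx : x ∈ closure D) :
    D.indicator u x = u x := by
  by_cases h : x ∈ D
  · exact indicator_of_mem h u
  · rw [indicator_of_notMem h, hu.boundary x ⟨hx, fun h' => h (interior_subset h')⟩]

theorem exists_lipschitzWith (hu : IsP2 D M u) (hM : IsMesh D M) :
    ∃ C, LipschitzWith C (D.indicator u) := by
  refine hM.exists_lipschitzWith (fun x hx => indicator_of_notMem hx u) fun s hs => ?_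
  obtain ⟨P, -, h⟩ := hu.exists_vecPoly hs
  exact ⟨vecPoly P, contDiff_vecPoly P, fun x hx => by
    rw [hu.indicator_eq (hM.elt_subset hs hx), h hx]⟩

theorem exists_lipschitzWith_norm_sq (hu : IsP2 D M u) (hM : IsMesh D M) :
    ∃ C, LipschitzWith C fun x => ‖D.indicator u x‖ ^ 2 := by
  refine hM.exists_lipschitzWith (fun x hx => by simp [indicator_of_notMem hx u]) fun s hs => ?_
  obtain ⟨P, -, h⟩ := hu.exists_vecPoly hs
  exact ⟨fun x => ‖vecPoly P x‖ ^ 2, (contDiff_vecPoly P).norm_sq ℝ, fun x hx => by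
    simp only [hu.indicator_eq (hM.elt_subset hs hx), h hx]⟩

end IsP2

end OldroydB

namespace OldroydB

variable {d : ℕ}

/-! ### Integration by parts against divergence-free Lipschitz fields -/

theorem fderiv_apply_eq_sum (G : Spc d → ℝ) (x v : Spc d) :
    fderiv ℝ G x v = ∑ j, v j * fderiv ℝ G x (EuclideanSpace.single j 1) := by
  have h : v = ∑ j, v j • EuclideanSpace.single j (1 : ℝ) := by
    simpa using ((EuclideanSpace.basisFun (Fin d) ℝ).sum_repr v).symm
  conv_lhs => rw [h]
  simp

theorem _root_.LipschitzWith.euclideanSpace_coord {w : Spc d → Spc d} {C : NNReal}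
    (hw : LipschitzWith C w) (j : Fin d) : LipschitzWith C fun x => w x j := by
  refine LipschitzWith.of_dist_le_mul fun x y => le_trans ?_ (hw.dist_le_mul x y)
  rw [dist_eq_norm, dist_eq_norm, ← PiLp.sub_apply]
  exact PiLp.norm_apply_le _ j

/-- By Rademacher's theorem the integrand is `∑ j, w_j ∂_j G` almost everywhere; integration by
parts for Lipschitz functions turns it into `-G div w`. Only `w` needs compact support. -/
theorem integral_fderiv_apply_eq_zero {G : Spc d → ℝ} {w : Spc d → Spc d} {C L : NNReal}
    (hG : LipschitzWith C G) (hw : LipschitzWith L w) (hcs : HasCompactSupport w)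
    (hdiv : ∀ᵐ x, dvg w x = 0) : ∫ x, fderiv ℝ G x (w x) = 0 := by
  set e : Fin d → Spc d := fun j => EuclideanSpace.single j 1
  have hwj (j : Fin d) : LipschitzWith L fun x => w x j := hw.euclideanSpace_coord j
  have hcsj (j : Fin d) : HasCompactSupport fun x => w x j :=
    hcs.comp_left (g := fun v : Spc d => v j) rfl
  have h1 : ∀ᵐ x, fderiv ℝ G x (w x) = ∑ j, lineDeriv ℝ G x (e j) * w x j := by
    filter_upwards [hG.ae_differentiableAt] with x hx
    rw [fderiv_apply_eq_sum]
    exact Finset.sum_congr rfl fun j _ => by rw [hx.lineDeriv_eq_fderiv, mul_comm]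
  have h2 (j : Fin d) : Integrable fun x => lineDeriv ℝ G x (e j) * w x j :=
    ((hwj j).continuous.integrable_of_hasCompactSupport (hcsj j)).bdd_mul
      (aestronglyMeasurable_lineDeriv hG.continuous _)
      (.of_forall fun x => norm_lineDeriv_le_of_lipschitz ℝ hG)
  have h3 (j : Fin d) : Integrable fun x => lineDeriv ℝ (fun x => w x j) x (-e j) * G x := by
    -- `G` need not be integrable, but the derivatives of `w` vanish off its compact support, where
    -- `G` is bounded.
    have hs : (Function.support fun x => lineDeriv ℝ (fun x => w x j) x (-e j) * G x) ⊆
        tsupport w := by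
      intro x hx
      by_contra hx'
      have h0 : (fun x => w x j) =ᶠ[nhds x] fun _ => 0 := by
        filter_upwards [(isClosed_tsupport w).isOpen_compl.mem_nhds hx'] with y hy
        rw [image_eq_zero_of_notMem_tsupport hy]; rfl
      apply hx
      simp only [h0.lineDeriv_eq]
      simp [lineDeriv]
    rw [← integrableOn_iff_integrable_of_support_subset hs]
    exact (hG.continuous.continuousOn.integrableOn_compact hcs).bdd_mul
      (aestronglyMeasurable_lineDeriv (hwj j).continuous _)
      (.of_forall fun x => norm_lineDeriv_le_of_lipschitz ℝ (hwj j))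
  rw [integral_congr_ae h1, integral_finsetSum _ fun j _ => h2 j]
  simp_rw [fun j => hG.integral_lineDeriv_mul_eq (μ := volume) (hwj j) (hcsj j) (e j)]
  rw [← integral_finsetSum _ fun j _ => h3 j]
  refine integral_eq_zero_of_ae ?_
  filter_upwards [hdiv, hw.ae_differentiableAt] with x hx hx'
  have h4 (j : Fin d) : lineDeriv ℝ (fun x => w x j) x (-e j) = - grad w x j j := by
    have : DifferentiableAt ℝ (fun y => w y j) x :=
      (EuclideanSpace.proj (𝕜 := ℝ) j).differentiableAt.comp x hx'
    rw [this.lineDeriv_eq_fderiv, map_neg, ← fderiv_apply_coord hx']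
    rfl
  simp only [h4, Pi.zero_apply, ← Finset.sum_mul, Finset.sum_neg_distrib]
  have : ∑ j, grad w x j j = 0 := hx
  rw [this]; simp

end OldroydB

/-! ### Flows of Lipschitz fields -/

/-- `Φ s x`, `0 ≤ s ≤ τ`, is the flow of the autonomous field `v` started at `x`. -/
structure IsForwardFlow {E : Type*} [NormedAddCommGroup E] [NormedSpace ℝ E] (v : E → E) (τ : ℝ)
    (Φ : ℝ → E → E) : Prop where
  initial : ∀ x, Φ 0 x = x
  continuousOn : ∀ x, ContinuousOn (fun s => Φ s x) (Icc 0 τ)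
  deriv : ∀ x, ∀ s ∈ Ico 0 τ, HasDerivWithinAt (fun r => Φ r x) (v (Φ s x)) (Ici s) s

namespace IsForwardFlow

section Normed

variable {E : Type*} [NormedAddCommGroup E] [NormedSpace ℝ E] {v : E → E} {τ : ℝ}
  {Φ : ℝ → E → E} {L : NNReal}

theorem lipschitzWith (hΦ : IsForwardFlow v τ Φ) (hv : LipschitzWith L v) {s : ℝ}
    (hs : s ∈ Icc 0 τ) : LipschitzWith (Real.toNNReal (Real.exp (L * s))) (Φ s) := by
  refine LipschitzWith.of_dist_le_mul fun x y => ?_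
  have h := dist_le_of_trajectories_ODE (v := fun _ => v) (fun _ => hv) (hΦ.continuousOn x)
    (hΦ.deriv x) (hΦ.continuousOn y) (hΦ.deriv y) (δ := dist x y)
    (by rw [hΦ.initial, hΦ.initial]) s hs
  rwa [sub_zero, mul_comm, ← Real.coe_toNNReal _ (Real.exp_pos (L * s)).le] at h

/-- Both sides solve the same ODE in `s`. This semigroup law lets a time increment act on the
starting point. -/
theorem apply_add (hΦ : IsForwardFlow v τ Φ) (hv : LipschitzWith L v) {s h : ℝ} (hs : 0 ≤ s)
    (hh : 0 ≤ h) (hsh : s + h ≤ τ) (x : E) : Φ (s + h) x = Φ s (Φ h x) := by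
  have hmaps : MapsTo (fun r => r + h) (Icc 0 s) (Icc 0 τ) := fun r hr =>
    ⟨add_nonneg hr.1 hh, (add_le_add_left hr.2 h).trans hsh⟩
  refine ODE_solution_unique (v := fun _ => v) (a := 0) (b := s)
    (f := fun r => Φ (r + h) x) (g := fun r => Φ r (Φ h x)) (fun _ => hv) ?_ ?_ ?_ ?_ ?_
    (right_mem_Icc.2 hs)
  · exact (hΦ.continuousOn x).comp (by fun_prop) hmaps
  · intro t ht
    have h1 := hΦ.deriv x (t + h) ⟨add_nonneg ht.1 hh, (add_lt_add_left ht.2 h).trans_le hsh⟩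
    have h2 : HasDerivWithinAt (fun r : ℝ => r + h) 1 (Ici t) t :=
      (hasDerivWithinAt_id t _).add_const h
    have := h1.scomp t h2 (fun r hr => add_le_add_left (mem_Ici.1 hr) h)
    simpa [Function.comp_def] using this
  · exact (hΦ.continuousOn _).mono (Icc_subset_Icc_right (by linarith))
  · exact fun t ht => hΦ.deriv _ t ⟨ht.1, ht.2.trans_le (by linarith)⟩
  · simp [hΦ.initial]

theorem norm_sub_le (hΦ : IsForwardFlow v τ Φ) {B : ℝ} (hB : ∀ x, ‖v x‖ ≤ B) {s : ℝ}
    (hs : s ∈ Icc 0 τ) (x : E) : ‖Φ s x - x‖ ≤ B * s := by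
  have := norm_image_sub_le_of_norm_deriv_right_le_segment (hΦ.continuousOn x) (hΦ.deriv x)
    (fun t _ => hB _) s hs
  simpa [hΦ.initial] using this

end Normed

section Euclidean

open OldroydB Filter Topology

variable {d : ℕ} {D : Set (Spc d)} {v : Spc d → Spc d} {τ : ℝ} {Φ : ℝ → Spc d → Spc d}
  {C L : NNReal}

/-- Put `G = g ∘ Φ s`, which is Lipschitz by Grönwall. Since `g (Φ r x) = G (Φ (r - s) x)`, the
difference quotients tend to `DG(x)(v x)` wherever `G` is differentiable, and this limit has zero
integral. -/
theorem hasDerivWithinAt_setIntegral_comp (hΦ : IsForwardFlow v τ Φ) (hv : LipschitzWith L v)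
    (hcs : HasCompactSupport v) (hdiv : ∀ᵐ x, dvg v x = 0) (hD : volume D < ⊤)
    (h0 : ∀ x, x ∉ D → v x = 0) {g : Spc d → ℝ} (hg : LipschitzWith C g)
    {K : ℝ} (hgK : ∀ x, ‖g x‖ ≤ K) {s : ℝ} (hs : s ∈ Ico 0 τ) :
    HasDerivWithinAt (fun s => ∫ x in D, g (Φ s x)) 0 (Ici s) s := by
  have : IsFiniteMeasure (volume.restrict D) := ⟨by simpa using hD⟩
  obtain ⟨B, hB⟩ := hcs.exists_bound_of_continuous hv.continuous
  have hlip {r : ℝ} (hr : r ∈ Icc 0 τ) := hg.comp (hΦ.lipschitzWith hv hr)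
  have hint {r : ℝ} (hr : r ∈ Icc 0 τ) : Integrable (fun x => g (Φ r x)) (volume.restrict D) :=
    .of_bound (hlip hr).continuous.aestronglyMeasurable K (.of_forall fun x => hgK _)
  have hs' : s ∈ Icc 0 τ := Ico_subset_Icc_self hs
  set G : Spc d → ℝ := g ∘ Φ s
  have hG := hlip hs'
  have hzero : ∫ x in D, fderiv ℝ G x (v x) = 0 := by
    rw [setIntegral_eq_integral_of_forall_compl_eq_zero fun x hx => by rw [h0 x hx, map_zero]]
    exact integral_fderiv_apply_eq_zero hG hv hcs hdiv
  have hmem : ∀ᶠ r in 𝓝[>] s, r ∈ Ioo s τ := Ioo_mem_nhdsGT hs.2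
  have hmem' {r : ℝ} (hr : r ∈ Ioo s τ) : r - s ∈ Icc 0 τ :=
    ⟨sub_nonneg.2 hr.1.le, by linarith [hs.1, hr.2]⟩
  have hsplit {r : ℝ} (hr : r ∈ Ioo s τ) (x : Spc d) : g (Φ r x) = G (Φ (r - s) x) := by
    have := hΦ.apply_add hv hs.1 (hmem' hr).1 (by linarith [hr.2]) x
    rw [add_sub_cancel] at this
    simp [G, this]
  rw [← hasDerivWithinAt_Ioi_iff_Ici, hasDerivWithinAt_iff_tendsto_slope' (notMem_Ioi.2 le_rfl),
    ← hzero]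
  have hslope : slope (fun s => ∫ x in D, g (Φ s x)) s =ᶠ[𝓝[>] s]
      fun r => ∫ x in D, (r - s)⁻¹ * (G (Φ (r - s) x) - G x) := by
    filter_upwards [hmem] with r hr
    rw [slope_def_module, smul_eq_mul, integral_const_mul,
      ← integral_sub (hint ⟨hs.1.trans hr.1.le, hr.2.le⟩) (hint hs')]
    simp_rw [hsplit hr]
    rfl
  refine Tendsto.congr' hslope.symm ?_
  -- The dominating constant is the Lipschitz constant of `G` times the bound `B` on the speed.
  refine tendsto_integral_filter_of_dominated_convergence
    (fun _ => (C * Real.toNNReal (Real.exp (L * s)) : NNReal) * B) ?_ ?_ (integrable_const _) ?_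
  · filter_upwards [hmem] with r hr
    refine Continuous.aestronglyMeasurable ?_
    exact continuous_const.mul ((hG.continuous.comp
      (hΦ.lipschitzWith hv (hmem' hr)).continuous).sub hG.continuous)
  · filter_upwards [hmem] with r hr
    refine .of_forall fun x => ?_
    have hpos : 0 < r - s := sub_pos.2 hr.1
    rw [norm_mul, norm_inv, Real.norm_of_nonneg hpos.le, inv_mul_le_iff₀ hpos]
    calc ‖G (Φ (r - s) x) - G x‖ ≤ _ * ‖Φ (r - s) x - x‖ := hG.norm_sub_le _ _
      _ ≤ (C * Real.toNNReal (Real.exp (L * s)) : NNReal) * (B * (r - s)) := by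
        gcongr
        exact hΦ.norm_sub_le hB (hmem' hr) x
      _ = _ := by ring
  · refine ae_restrict_of_ae ?_
    filter_upwards [hG.ae_differentiableAt] with x hx
    have hτ : (0 : ℝ) ∈ Ico 0 τ := ⟨le_rfl, hs.1.trans_lt hs.2⟩
    have h1 : HasDerivWithinAt (fun r => Φ r x) (v x) (Ici 0) 0 := by
      simpa only [hΦ.initial] using hΦ.deriv x 0 hτ
    have h2 : HasDerivWithinAt (fun r => Φ (r - s) x) (v x) (Ioi s) s := by
      have h3 : HasDerivWithinAt (fun r : ℝ => r - s) 1 (Ioi s) s :=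
        (hasDerivWithinAt_id s _).sub_const s
      have h4 := HasDerivWithinAt.scomp_of_eq s h1 h3
        (fun r hr => sub_nonneg.2 (le_of_lt (mem_Ioi.1 hr))) (sub_self s).symm
      simpa [Function.comp_def] using h4
    have hx' : HasFDerivAt G (fderiv ℝ G x) (Φ (s - s) x) := by
      rw [sub_self, hΦ.initial]; exact hx.hasFDerivAt
    have h5 := hx'.comp_hasDerivWithinAt s h2
    rw [hasDerivWithinAt_iff_tendsto_slope' (notMem_Ioi.2 le_rfl)] at h5
    refine h5.congr fun r => ?_
    simp [slope_def_module, hΦ.initial]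

/-- The flow of a compactly supported, Lipschitz, divergence-free field preserves the Lebesgue
measure of any set of finite measure outside which the field vanishes. -/
theorem measurePreserving (hΦ : IsForwardFlow v τ Φ) (hτ : 0 ≤ τ) (hv : LipschitzWith L v)
    (hcs : HasCompactSupport v) (hdiv : ∀ᵐ x, dvg v x = 0) (hD : volume D < ⊤)
    (h0 : ∀ x, x ∉ D → v x = 0) :
    MeasurePreserving (Φ τ) (volume.restrict D) (volume.restrict D) := by
  have : IsFiniteMeasure (volume.restrict D) := ⟨by simpa using hD⟩
  have hcont {s : ℝ} (hs : s ∈ Icc 0 τ) : Continuous (Φ s) := (hΦ.lipschitzWith hv hs).continuous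
  have hτ' : τ ∈ Icc 0 τ := right_mem_Icc.2 hτ
  have key {C : NNReal} {g : Spc d → ℝ} (hg : LipschitzWith C g) {K : ℝ}
      (hgK : ∀ x, ‖g x‖ ≤ K) : ∫ x in D, g (Φ τ x) = ∫ x in D, g x := by
    have hc : ContinuousOn (fun s => ∫ x in D, g (Φ s x)) (Icc 0 τ) :=
      continuousOn_of_dominated (bound := fun _ => K)
        (fun s hs => (hg.continuous.comp (hcont hs)).aestronglyMeasurable)
        (fun s _ => .of_forall fun x => hgK _) (integrable_const _)
        (.of_forall fun x => hg.continuous.comp_continuousOn (hΦ.continuousOn x))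
    have := constant_of_has_deriv_right_zero hc
      (fun s hs => hΦ.hasDerivWithinAt_setIntegral_comp hv hcs hdiv hD h0 hg hgK hs) τ hτ'
    simpa [hΦ.initial] using this
  have hmeas : Measurable (Φ τ) := (hcont hτ').measurable
  refine ⟨hmeas, ?_⟩
  set μ := volume.restrict D
  have hfin : IsFiniteMeasure (μ.map (Φ τ)) := Measure.isFiniteMeasure_map μ _
  -- Thickened indicators of a closed set are Lipschitz and bounded by 1, so `key` applies to them;
  -- their limit gives equality on closed sets, a π-system generating the Borel sets.
  have hclosed (F : Set (Spc d)) (hF : IsClosed F) : μ.map (Φ τ) F = μ F := by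
    have hδ (n : ℕ) : (0 : ℝ) < 1 / (n + 1) := Nat.one_div_pos_of_nat
    have l1 := tendsto_integral_thickenedIndicator_of_isClosed (μ.map (Φ τ)) hF hδ
      tendsto_one_div_add_atTop_nhds_zero_nat
    have l2 := tendsto_integral_thickenedIndicator_of_isClosed μ hF hδ
      tendsto_one_div_add_atTop_nhds_zero_nat
    have heq (n : ℕ) : ∫ x, (thickenedIndicator (hδ n) F x : ℝ) ∂(μ.map (Φ τ)) =
        ∫ x, (thickenedIndicator (hδ n) F x : ℝ) ∂μ := by
      rw [integral_map hmeas.aemeasurable (by fun_prop)]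
      exact key (g := fun x => (thickenedIndicator (hδ n) F x : ℝ)) (K := 1)
        (lipschitzWith_thickenedIndicator (hδ n) F)
        (fun x => by simpa using thickenedIndicator_le_one (hδ n) F x)
    simp_rw [heq] at l1
    exact (measureReal_eq_measureReal_iff).1 (tendsto_nhds_unique l1 l2)
  refine ext_of_generate_finite _ ?_ isPiSystem_isClosed hclosed (hclosed _ isClosed_univ)
  exact (BorelSpace.measurable_eq (α := Spc d)).trans borel_eq_generateFrom_isClosed

end Euclidean

end IsForwardFlow

namespace OldroydB

variable {d : ℕ} {D : Set (Spc d)} {M : Geometry.SimplicialComplex ℝ (Spc d)}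

/-! ### Divergence-free finite element fields -/

theorem IsP2.ae_dvg_eq_zero {u : Spc d → Spc d} (hu : IsP2 D M u) (hM : IsMesh D M)
    (h : ∫ x in D, dvg u x * dvg u x = 0) : ∀ᵐ x ∂volume.restrict D, dvg u x = 0 := by
  have hint : Integrable (fun x => dvg u x * dvg u x) (volume.restrict D) :=
    (hu.isPwCont_dvg.comp₂ hu.isPwCont_dvg continuous_mul).integrable hM
  rw [integral_eq_zero_iff_of_nonneg (fun x => mul_self_nonneg _) hint] at h
  filter_upwards [h] with x hx
  exact mul_self_eq_zero.1 hx

theorem IsMesh.ae_dvg_indicator_eq_zero (hM : IsMesh D M) {u : Spc d → Spc d}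
    (h : ∀ᵐ x ∂volume.restrict D, dvg u x = 0) : ∀ᵐ x, dvg (D.indicator u) x = 0 := by
  rw [ae_restrict_iff' hM.isOpen.measurableSet] at h
  have hnull : ∀ᵐ x, x ∉ closure D \ openCells M :=
    measure_eq_zero_iff_ae_notMem.1 hM.volume_closure_diff_openCells
  filter_upwards [h, hnull] with x hx hx'
  by_cases hxD : x ∈ closure D
  · have hxc : x ∈ openCells M := by
      by_contra hc
      exact hx' ⟨hxD, hc⟩
    have hD : x ∈ D := hM.openCells_subset hxc
    have : grad (D.indicator u) x = grad u x :=
      grad_congr (S := D) (fun y hy => indicator_of_mem hy u)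
        (by rwa [hM.isOpen.interior_eq])
    rw [dvg, this]
    exact hx hD
  · have : grad (D.indicator u) x = grad (fun _ => 0) x :=
      grad_congr (S := Dᶜ) (fun y hy => indicator_of_notMem hy u)
        (by rwa [interior_compl])
    rw [dvg, this]
    simp [grad, Matrix.trace]

theorem hasCompactSupport_indicator (hM : IsMesh D M) (u : Spc d → Spc d) :
    HasCompactSupport (D.indicator u) :=
  HasCompactSupport.intro hM.isCompact_closure fun _ hx =>
    indicator_of_notMem (fun h => hx (subset_closure h)) u

/-! ### The advection term -/

theorem advect_eq_fderiv (w u : Spc d → Spc d) (x : Spc d) :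
    advect w u x = fderiv ℝ u x (w x) := by
  have h : w x = ∑ j, w x j • EuclideanSpace.single j (1 : ℝ) := by
    simpa using ((EuclideanSpace.basisFun (Fin d) ℝ).sum_repr (w x)).symm
  conv_rhs => rw [h]
  ext i
  simp [advect, grad]

theorem isPwCont_advect {w u : Spc d → Spc d} (hw : IsP2 D M w) (hu : IsP2 D M u) :
    IsPwCont M (advect w u) := by
  refine hw.isPwCont.comp₂ hu.isPwCont_grad
    (h := fun (w : Spc d) (A : Matrix (Fin d) (Fin d) ℝ) =>
      (WithLp.toLp 2 fun i => ∑ j, w j * A i j : Spc d)) ?_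
  refine (PiLp.continuous_toLp 2 _).comp (continuous_pi fun i => ?_)
  refine continuous_finsetSum _ fun j _ => ?_
  exact (((EuclideanSpace.proj (𝕜 := ℝ) j).continuous).comp continuous_fst).mul
    (continuous_snd.matrix_elem i j)

theorem integral_inner_advect_self {w u : Spc d → Spc d} (hM : IsMesh D M) (hw : IsP2 D M w)
    (hu : IsP2 D M u) (hdiv : ∀ᵐ x ∂volume.restrict D, dvg w x = 0) :
    ∫ x in D, inner ℝ (advect w u x) (u x) = 0 := by
  obtain ⟨L, hL⟩ := hw.exists_lipschitzWith hM
  obtain ⟨C, hC⟩ := hu.exists_lipschitzWith_norm_sq hM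
  have h0 := integral_fderiv_apply_eq_zero hC hL (hasCompactSupport_indicator hM w)
    (hM.ae_dvg_indicator_eq_zero hdiv)
  rw [← setIntegral_eq_integral_of_forall_compl_eq_zero (s := D)
    fun x hx => by rw [indicator_of_notMem hx, map_zero]] at h0
  have h1 : ∀ᵐ x ∂volume.restrict D, fderiv ℝ (fun x => ‖D.indicator u x‖ ^ 2) x
      (D.indicator w x) = 2 * inner ℝ (advect w u x) (u x) := by
    filter_upwards [hM.ae_mem_openCells] with x hx
    have hxD := hM.openCells_subset hx
    have heq : (fun x => ‖D.indicator u x‖ ^ 2) =ᶠ[nhds x] fun x => ‖u x‖ ^ 2 := by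
      filter_upwards [hM.isOpen.mem_nhds hxD] with y hy
      rw [indicator_of_mem hy]
    rw [heq.fderiv_eq, indicator_of_mem hxD, (hu.differentiableAt hx).hasFDerivAt.norm_sq.fderiv,
      advect_eq_fderiv, real_inner_comm]
    simp
  rw [integral_congr_ae h1, integral_const_mul] at h0
  simpa using h0

/-! ### The backward flow preserves volume -/

/-- Time is reversed by `s ↦ b - s`, and points outside `D` are frozen, as the zero extension of `u`
prescribes. -/
theorem IsBackwardFlow.isForwardFlow {u : Spc d → Spc d} {a b : ℝ} {X : ℝ → Spc d → Spc d}
    [DecidablePred (· ∈ D)] (hX : IsBackwardFlow D u a b X) :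
    IsForwardFlow (fun x => -D.indicator u x) (b - a)
      (fun s x => if x ∈ D then X (b - s) x else x) := by
  have hmaps : MapsTo (fun s => b - s) (Icc 0 (b - a)) (Icc a b) := fun s hs =>
    ⟨by linarith [hs.2], by linarith [hs.1]⟩
  have hder {x : Spc d} (hx : x ∈ D) {s : ℝ} (hs : s ∈ Icc 0 (b - a)) :
      HasDerivWithinAt (fun r => X (b - r) x) (-u (X (b - s) x)) (Icc 0 (b - a)) s := by
    have h1 : HasDerivWithinAt (fun r : ℝ => b - r) (-1) (Icc 0 (b - a)) s :=
      (hasDerivWithinAt_id s _).const_sub b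
    have := (hX.deriv x hx (b - s) (hmaps hs)).scomp s h1 hmaps
    simpa [Function.comp_def] using this
  refine ⟨fun x => ?_, fun x => ?_, fun x s hs => ?_⟩
  · by_cases hx : x ∈ D
    · simp [hx, hX.final x hx]
    · simp [hx]
  · by_cases hx : x ∈ D
    · simp only [hx, if_true]
      exact fun s hs => (hder hx hs).continuousWithinAt
    · simp only [hx, if_false]
      exact continuousOn_const
  · by_cases hx : x ∈ D
    · have hs' := Ico_subset_Icc_self hs
      simp only [hx, if_true, indicator_of_mem (hX.mem x hx _ (hmaps hs'))]
      exact (hder hx hs').mono_of_mem_nhdsWithin (Icc_mem_nhdsGE_of_mem hs)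
    · simp only [hx, if_false, indicator_of_notMem hx, neg_zero]
      exact hasDerivWithinAt_const _ _ _

/-- `X a` is controlled only on `D`, so measurability is claimed for a map `Y` that agrees with it
there. -/
theorem IsBackwardFlow.measurePreserving {u : Spc d → Spc d} {a b : ℝ} {X : ℝ → Spc d → Spc d}
    (hX : IsBackwardFlow D u a b X) (hab : a ≤ b) (hM : IsMesh D M) (hu : IsP2 D M u)
    (hdiv : ∀ᵐ x ∂volume.restrict D, dvg u x = 0) :
    ∃ Y, MeasurePreserving Y (volume.restrict D) (volume.restrict D) ∧ EqOn (X a) Y D := by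
  classical
  obtain ⟨L, hL⟩ := hu.exists_lipschitzWith hM
  have hdiv' : ∀ᵐ x, dvg (fun x => -D.indicator u x) x = 0 := by
    filter_upwards [hM.ae_dvg_indicator_eq_zero hdiv] with x hx
    have : grad (fun x => -D.indicator u x) x = -grad (D.indicator u) x := by
      ext i j
      simp [grad, fderiv_fun_neg]
    rw [dvg, this, Matrix.trace_neg, ← dvg, hx, neg_zero]
  refine ⟨_, hX.isForwardFlow.measurePreserving (sub_nonneg.2 hab) hL.neg
    (hasCompactSupport_indicator hM u).neg hdiv' hM.volume_lt_top
    (fun x hx => by rw [indicator_of_notMem hx, neg_zero]), fun x hx => ?_⟩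
  simp [hx]

/-! ### Double contractions -/

open Matrix in
theorem dcontr_eq_trace (A B : Matrix (Fin d) (Fin d) ℝ) : dcontr A B = (A * Bᵀ).trace := by
  simp [dcontr, Matrix.trace, Matrix.mul_apply]

theorem dcontr_smul_left (c : ℝ) (A B : Matrix (Fin d) (Fin d) ℝ) :
    dcontr (c • A) B = c * dcontr A B := by
  simp [dcontr_eq_trace]

theorem dcontr_smul_right (c : ℝ) (A B : Matrix (Fin d) (Fin d) ℝ) :
    dcontr A (c • B) = c * dcontr A B := by
  simp [dcontr_eq_trace]

theorem dcontr_sub_left (A B C : Matrix (Fin d) (Fin d) ℝ) :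
    dcontr (A - B) C = dcontr A C - dcontr B C := by
  simp [dcontr_eq_trace, Matrix.sub_mul]

theorem continuous_dcontr :
    Continuous fun z : Matrix (Fin d) (Fin d) ℝ × Matrix (Fin d) (Fin d) ℝ => dcontr z.1 z.2 :=
  continuous_finsetSum _ fun i _ => continuous_finsetSum _ fun j _ =>
    (continuous_fst.matrix_elem i j).mul (continuous_snd.matrix_elem i j)

theorem dcontr_self_nonneg (A : Matrix (Fin d) (Fin d) ℝ) : 0 ≤ dcontr A A :=
  Finset.sum_nonneg fun _ _ => Finset.sum_nonneg fun _ _ => mul_self_nonneg _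

/-! ### Matrix identities for the test function `I - S⁻¹` -/

section PosDef

open Matrix

variable {A B S : Matrix (Fin d) (Fin d) ℝ}

theorem isSymm_of_posDef (hS : S.PosDef) : Sᵀ = S := by
  simpa [conjTranspose_eq_transpose_of_trivial] using hS.1.eq

theorem mul_inv_of_posDef (hS : S.PosDef) : S * S⁻¹ = 1 :=
  mul_nonsing_inv _ hS.det_pos.ne'.isUnit

theorem inv_mul_of_posDef (hS : S.PosDef) : S⁻¹ * S = 1 :=
  nonsing_inv_mul _ hS.det_pos.ne'.isUnit

theorem dcontr_one_sub_inv (hS : S.PosDef) (A : Matrix (Fin d) (Fin d) ℝ) :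
    dcontr A (1 - S⁻¹) = A.trace - (A * S⁻¹).trace := by
  rw [dcontr_eq_trace, transpose_sub, transpose_one, isSymm_of_posDef hS.inv, mul_sub, mul_one,
    trace_sub]

theorem dcontr_stretching (hS : S.PosDef) (A : Matrix (Fin d) (Fin d) ℝ) :
    dcontr (A * S + S * Aᵀ) (1 - S⁻¹) = 2 * dcontr S A - 2 * A.trace := by
  have h1 : (A * S).trace = (S * Aᵀ).trace := by
    rw [← trace_transpose (A * S), transpose_mul, isSymm_of_posDef hS]
  have h2 : (A * S * S⁻¹).trace = A.trace := by
    rw [Matrix.mul_assoc, mul_inv_of_posDef hS, mul_one]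
  have h3 : (S * Aᵀ * S⁻¹).trace = A.trace := by
    rw [trace_mul_cycle, inv_mul_of_posDef hS, one_mul, trace_transpose]
  rw [dcontr_one_sub_inv hS, Matrix.add_mul, trace_add, trace_add, h1, h2, h3, dcontr_eq_trace S A]
  ring

theorem dcontr_relaxation (hS : S.PosDef) :
    dcontr (S - 1) (1 - S⁻¹) = (S + S⁻¹ - (2 : ℝ) • (1 : Matrix (Fin d) (Fin d) ℝ)).trace := by
  rw [dcontr_one_sub_inv hS, Matrix.sub_mul, mul_inv_of_posDef hS, one_mul]
  simp only [trace_sub, trace_add, trace_smul, smul_eq_mul]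
  ring

theorem entropy_sub_le_dcontr (hA : A.PosDef) (hS : S.PosDef) :
    (S - matLog S - 1).trace - (A - matLog A - 1).trace ≤ dcontr (S - A) (1 - S⁻¹) := by
  have h := hA.log_det_sub_log_det_le hS
  rw [dcontr_one_sub_inv hS, Matrix.sub_mul, mul_inv_of_posDef hS]
  simp only [trace_sub, matLog, hA.trace_cfc_log, hS.trace_cfc_log, trace_one]
  linarith

end PosDef

/-! ### Piecewise constant stresses -/

/-- No continuity of `f` is needed, as `σ` is constant inside each element; this covers the
logarithm and the inverse. -/
theorem IsP0sym.isPwCont_comp {σ : Spc d → Matrix (Fin d) (Fin d) ℝ} (hσ : IsP0sym M σ)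
    {F : Type*} [TopologicalSpace F] (f : Matrix (Fin d) (Fin d) ℝ → F) :
    IsPwCont M fun x => f (σ x) := by
  intro s hs
  obtain ⟨A, -, hA⟩ := hσ s hs
  exact ⟨fun _ => f A, continuous_const, fun x hx => by simp only [hA x hx]⟩

theorem IsP0sym.smul_one_sub_inv {σ : Spc d → Matrix (Fin d) (Fin d) ℝ} (hσ : IsP0sym M σ)
    (c : ℝ) : IsP0sym M fun x => c • (1 - (σ x)⁻¹) := by
  intro s hs
  obtain ⟨A, hA, hσA⟩ := hσ s hs
  refine ⟨c • (1 - A⁻¹), ?_, fun x hx => by simp only [hσA x hx]⟩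
  rw [Matrix.IsSymm, Matrix.transpose_smul, Matrix.transpose_sub, Matrix.transpose_one,
    Matrix.transpose_nonsing_inv, hA]

theorem IsPwCont.exists_bound {f : Spc d → ℝ} (hf : IsPwCont M f) (hM : IsMesh D M) :
    ∃ C, ∀ᵐ x ∂volume.restrict D, ‖f x‖ ≤ C := by
  have hC : ∀ s : cells M, ∃ C, 0 ≤ C ∧ ∀ x ∈ interior (elt s.1), ‖f x‖ ≤ C := by
    rintro ⟨s, hs⟩
    obtain ⟨g, hg, hfg⟩ := hf s hs
    obtain ⟨C, hC⟩ := (isCompact_elt s).exists_bound_of_continuousOn hg.continuousOn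
    exact ⟨max C 0, le_max_right _ _, fun x hx => by
      rw [hfg hx]; exact (hC x (interior_subset hx)).trans (le_max_left _ _)⟩
  choose C hC0 hC using hC
  have := hM.finite.to_subtype
  have := Fintype.ofFinite (cells M)
  refine ⟨∑ s, C s, hM.ae_of_forall_cells fun s hs x hx => (hC ⟨s, hs⟩ x hx).trans ?_⟩
  exact Finset.single_le_sum (fun s _ => hC0 s) (Finset.mem_univ _)

end OldroydB

namespace OldroydB

variable {d : ℕ} {D : Set (Spc d)} {M : Geometry.SimplicialComplex ℝ (Spc d)}

/-! ### One time step -/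

/-- `σ₀ ∘ Y` is no longer piecewise constant; its integrability comes from measure preservation, and
`φ` is bounded. -/
theorem integrable_dcontr_comp {σ₀ φ : Spc d → Matrix (Fin d) (Fin d) ℝ}
    {Y : Spc d → Spc d} (hY : MeasurePreserving Y (volume.restrict D) (volume.restrict D))
    (hM : IsMesh D M) (hσ₀ : IsP0sym M σ₀) (hφ : IsP0sym M φ) :
    Integrable (fun x => dcontr (σ₀ (Y x)) (φ x)) (volume.restrict D) := by
  refine integrable_finsetSum _ fun i _ => integrable_finsetSum _ fun j _ => ?_
  have h1 : Integrable (fun x => σ₀ (Y x) i j) (volume.restrict D) :=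
    hY.integrable_comp_of_integrable ((hσ₀.isPwCont_comp fun A => A i j).integrable hM)
  have h2 : IsPwCont M fun x => φ x i j := hφ.isPwCont_comp fun A => A i j
  obtain ⟨C, hC⟩ := h2.exists_bound hM
  exact h1.mul_bdd (h2.integrable hM).aestronglyMeasurable hC

theorem integral_linear_combination {α : Type*} [MeasurableSpace α] {μ : Measure α}
    {f₁ f₂ f₃ f₄ f₅ f₆ : α → ℝ} (h₁ : Integrable f₁ μ) (h₂ : Integrable f₂ μ)
    (h₃ : Integrable f₃ μ) (h₄ : Integrable f₄ μ) (h₅ : Integrable f₅ μ) (h₆ : Integrable f₆ μ)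
    {a b r s : ℝ} :
    ∫ x, (a * f₁ x - a * f₂ x + b * f₃ x + r * f₄ x + f₅ x + s * f₆ x) ∂μ =
      a * (∫ x, f₁ x ∂μ) - a * (∫ x, f₂ x ∂μ) + b * (∫ x, f₃ x ∂μ) + r * (∫ x, f₄ x ∂μ)
        + (∫ x, f₅ x ∂μ) + s * ∫ x, f₆ x ∂μ := by
  rw [integral_add (by fun_prop) (by fun_prop), integral_add (by fun_prop) (by fun_prop),
    integral_add (by fun_prop) (by fun_prop), integral_add (by fun_prop) (by fun_prop),
    integral_sub (by fun_prop) (by fun_prop)]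
  simp only [integral_const_mul]

/-- The entropy density `tr(σ - ln σ - I)`. -/
noncomputable def entropy (A : Matrix (Fin d) (Fin d) ℝ) : ℝ := (A - matLog A - 1).trace

/-- Energy estimate for one step of the scheme, tested with the velocity, the pressure and a
multiple of `I - σ⁻¹`. -/
theorem freeEnergy_step_le (hM : IsMesh D M) {Re Wi ε Δt : ℝ} (hWi : 0 < Wi) (hε : 0 ≤ ε)
    (hΔt : 0 < Δt) {u₀ u : Spc d → Spc d} {p : Spc d → ℝ}
    {σ₀ σ : Spc d → Matrix (Fin d) (Fin d) ℝ} {Y : Spc d → Spc d}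
    (hu₀ : IsP2 D M u₀) (hu : IsP2 D M u) (hσ₀ : IsP0sym M σ₀) (hσ : IsP0sym M σ)
    (hpos₀ : IsPosDefField M σ₀) (hpos : IsPosDefField M σ)
    (hY : MeasurePreserving Y (volume.restrict D) (volume.restrict D))
    (hdiv₀ : ∀ᵐ x ∂volume.restrict D, dvg u₀ x = 0) (hdiv : ∀ᵐ x ∂volume.restrict D, dvg u x = 0)
    (hstep : stepForm D Re Wi ε Δt u₀ σ₀ Y u p σ u p
      (fun x => (ε / (2 * Wi)) • (1 - (σ x)⁻¹)) = 0) :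
    freeEnergy D Re Wi ε u σ - freeEnergy D Re Wi ε u₀ σ₀
      + (∫ x in D, Re / 2 * ‖u x - u₀ x‖ ^ 2)
      + Δt * (∫ x in D, ((1 - ε) * dcontr (grad u x) (grad u x)
        + ε / (2 * Wi ^ 2) *
          (σ x + (σ x)⁻¹ - (2 : ℝ) • (1 : Matrix (Fin d) (Fin d) ℝ)).trace)) ≤ 0 := by
  have hsp : ∀ᵐ x ∂volume.restrict D, (σ x).PosDef := hM.ae_of_forall_cells hpos
  have hsp₀ : ∀ᵐ x ∂volume.restrict D, (σ₀ x).PosDef := hM.ae_of_forall_cells hpos₀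
  have hspY : ∀ᵐ x ∂volume.restrict D, (σ₀ (Y x)).PosDef := hY.quasiMeasurePreserving.ae hsp₀
  -- Since stretching yields `2 σ : ∇u`, this weight makes `2 c = ε / Wi`, the coefficient of the
  -- polymer stress.
  set c : ℝ := ε / (2 * Wi) with hc
  have hc0 : 0 ≤ c := by positivity
  -- integrability of all terms
  have i1 : Integrable (fun x => ‖u x‖ ^ 2) (volume.restrict D) :=
    (hu.isPwCont.comp (continuous_norm.pow 2)).integrable hM
  have i2 : Integrable (fun x => ‖u₀ x‖ ^ 2) (volume.restrict D) :=
    (hu₀.isPwCont.comp (continuous_norm.pow 2)).integrable hM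
  have i3 : Integrable (fun x => Re / 2 * ‖u x - u₀ x‖ ^ 2) (volume.restrict D) :=
    ((hu.isPwCont.comp₂ hu₀.isPwCont (h := fun a b => Re / 2 * ‖a - b‖ ^ 2)
      (by fun_prop)).integrable hM)
  have i4 : Integrable (fun x => inner ℝ (advect u₀ u x) (u x)) (volume.restrict D) :=
    ((isPwCont_advect hu₀ hu).comp₂ hu.isPwCont continuous_inner).integrable hM
  have i5 : Integrable (fun x => (1 - ε) * dcontr (grad u x) (grad u x)
      + ε / (2 * Wi ^ 2) * (σ x + (σ x)⁻¹ - (2 : ℝ) • (1 : Matrix (Fin d) (Fin d) ℝ)).trace)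
      (volume.restrict D) :=
    (((hu.isPwCont_grad.comp₂ hu.isPwCont_grad continuous_dcontr).integrable hM).const_mul _).add
      (((hσ.isPwCont_comp fun A => (A + A⁻¹ - (2 : ℝ) • 1).trace).integrable hM).const_mul _)
  have i6 : Integrable (fun x => entropy (σ x)) (volume.restrict D) :=
    (hσ.isPwCont_comp entropy).integrable hM
  have i7 : Integrable (fun x => entropy (σ₀ x)) (volume.restrict D) :=
    (hσ₀.isPwCont_comp entropy).integrable hM
  have i7' : Integrable (fun x => entropy (σ₀ (Y x))) (volume.restrict D) :=
    hY.integrable_comp_of_integrable i7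
  have i8 : Integrable (fun x => dcontr (σ x - σ₀ (Y x)) (c • (1 - (σ x)⁻¹)))
      (volume.restrict D) := by
    simp_rw [dcontr_sub_left]
    exact ((hσ.isPwCont_comp fun A => dcontr A (c • (1 - A⁻¹))).integrable hM).sub
      (integrable_dcontr_comp hY hM hσ₀ (hσ.smul_one_sub_inv c))
  -- the entropy inequality, integrated along the flow
  have hent : c * ((∫ x in D, entropy (σ x)) - ∫ x in D, entropy (σ₀ x)) ≤
      ∫ x in D, dcontr (σ x - σ₀ (Y x)) (c • (1 - (σ x)⁻¹)) := by
    have hinv : ∫ x in D, entropy (σ₀ (Y x)) = ∫ x in D, entropy (σ₀ x) := by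
      have h := integral_map (μ := volume.restrict D) hY.measurable.aemeasurable
        (f := fun x => entropy (σ₀ x)) (by rw [hY.map_eq]; exact i7.aestronglyMeasurable)
      rw [hY.map_eq] at h
      exact h.symm
    rw [← hinv, ← integral_sub i6 i7', ← integral_const_mul]
    refine integral_mono_ae ((i6.sub i7').const_mul c) i8 ?_
    filter_upwards [hsp, hspY] with x hx hx'
    simp only [dcontr_smul_right]
    exact mul_le_mul_of_nonneg_left (entropy_sub_le_dcontr hx' hx) hc0
  -- the integrand of the scheme
  have hform : (∫ x in D, (Re / (2 * Δt) * ‖u x‖ ^ 2 - Re / (2 * Δt) * ‖u₀ x‖ ^ 2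
      + Δt⁻¹ * (Re / 2 * ‖u x - u₀ x‖ ^ 2) + Re * inner ℝ (advect u₀ u x) (u x)
      + ((1 - ε) * dcontr (grad u x) (grad u x) + ε / (2 * Wi ^ 2) *
          (σ x + (σ x)⁻¹ - (2 : ℝ) • (1 : Matrix (Fin d) (Fin d) ℝ)).trace)
      + Δt⁻¹ * dcontr (σ x - σ₀ (Y x)) (c • (1 - (σ x)⁻¹)))) = 0 := by
    rw [← hstep, stepForm]
    refine integral_congr_ae ?_
    filter_upwards [hsp, hdiv] with x hx hx'
    have hin : inner ℝ (u x - u₀ x) (u x) =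
        (‖u x‖ ^ 2 - ‖u₀ x‖ ^ 2 + ‖u x - u₀ x‖ ^ 2) / 2 := by
      rw [norm_sub_sq_real, inner_sub_left, real_inner_self_eq_norm_sq, real_inner_comm]
      ring
    -- The stretching and polymer stress terms now cancel, as do the two pressure terms, and `c /
    -- Wi` is the dissipation coefficient.
    rw [inner_add_left, real_inner_smul_left, hin, dcontr_smul_left,
      dcontr_smul_right c (_ + _), dcontr_smul_right c (σ x - 1), dcontr_stretching hx,
      dcontr_relaxation hx, show (grad u x).trace = 0 from hx', hc]
    field_simp
    ring
  rw [integral_linear_combination i1 i2 i3 i4 i5 i8, integral_inner_advect_self hM hu₀ hu hdiv₀]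
    at hform
  simp only [freeEnergy]
  change Re / 2 * _ + c * (∫ x in D, entropy (σ x)) -
    (Re / 2 * _ + c * ∫ x in D, entropy (σ₀ x)) + _ + _ ≤ _
  have hmul := congrArg (fun r => Δt * r) hform
  simp only [mul_zero] at hmul
  generalize (∫ x in D, dcontr (σ x - σ₀ (Y x)) (c • (1 - (σ x)⁻¹))) = a8 at hent hmul
  generalize (∫ x in D, ((1 - ε) * dcontr (grad u x) (grad u x) + ε / (2 * Wi ^ 2) *
    (σ x + (σ x)⁻¹ - (2 : ℝ) • (1 : Matrix (Fin d) (Fin d) ℝ)).trace)) = a5 at hmul ⊢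
  generalize (∫ x in D, Re / 2 * ‖u x - u₀ x‖ ^ 2) = a3 at hmul ⊢
  field_simp at hmul
  linarith

theorem dissipation_nonneg (hM : IsMesh D M) {Wi ε : ℝ} (hε₀ : 0 ≤ ε) (hε₁ : ε < 1)
    (u : Spc d → Spc d) {σ : Spc d → Matrix (Fin d) (Fin d) ℝ} (hpos : IsPosDefField M σ) :
    0 ≤ ∫ x in D, ((1 - ε) * dcontr (grad u x) (grad u x)
        + ε / (2 * Wi ^ 2) *
          (σ x + (σ x)⁻¹ - (2 : ℝ) • (1 : Matrix (Fin d) (Fin d) ℝ)).trace) := by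
  refine integral_nonneg_of_ae ?_
  filter_upwards [hM.ae_of_forall_cells hpos] with x hx
  exact add_nonneg (mul_nonneg (sub_nonneg.2 hε₁.le) (dcontr_self_nonneg _))
    (mul_nonneg (by positivity) hx.trace_add_inv_sub_two_nonneg)

/-! ### The scheme -/

theorem IsP2.zero : IsP2 D M fun _ => 0 where
  continuousOn := continuousOn_const
  boundary _ _ := rfl
  poly _ _ _ := ⟨0, by simp, by simp⟩

theorem IsP0sym.zero : IsP0sym M fun _ => 0 :=
  fun _ _ => ⟨0, Matrix.isSymm_zero, fun _ _ => rfl⟩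

theorem stepForm_congr_foot (hD : MeasurableSet D) {Re Wi ε Δt : ℝ} {u₀ u v : Spc d → Spc d}
    {p q : Spc d → ℝ} {σ₀ σ φ : Spc d → Matrix (Fin d) (Fin d) ℝ} {Y Y' : Spc d → Spc d}
    (h : EqOn Y Y' D) : stepForm D Re Wi ε Δt u₀ σ₀ Y u p σ v q φ =
      stepForm D Re Wi ε Δt u₀ σ₀ Y' u p σ v q φ := by
  refine setIntegral_congr_fun hD fun x hx => ?_
  simp only [h hx]

variable {Re Wi ε T : ℝ} {N : ℕ} {u : ℕ → Spc d → Spc d} {p : ℕ → Spc d → ℝ}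
  {σ : ℕ → Spc d → Matrix (Fin d) (Fin d) ℝ} {X : ℕ → ℝ → Spc d → Spc d}

/-- The test function `(0, q, 0)` isolates the incompressibility constraint. -/
theorem IsSolution.integral_mul_dvg (hsol : IsSolution D M Re Wi ε T N u p σ X) {n : ℕ}
    (hn : n < N) {q : Spc d → ℝ} (hq : IsP1disc M q) :
    ∫ x in D, q x * dvg (u (n + 1)) x = 0 := by
  have h := hsol.step n hn _ q _ IsP2.zero hq IsP0sym.zero
  have h0 (x : Spc d) : grad (fun _ => (0 : Spc d)) x = 0 := by ext; simp [grad]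
  simpa [stepForm, dvg, h0, dcontr] using h

theorem IsSolution.ae_dvg_eq_zero (hsol : IsSolution D M Re Wi ε T N u p σ X) (hM : IsMesh D M)
    (hdiv : ∀ q, IsP1disc M q → ∫ x in D, q x * dvg (u 0) x = 0) {n : ℕ} (hn : n ≤ N) :
    ∀ᵐ x ∂volume.restrict D, dvg (u n) x = 0 := by
  refine (hsol.velocity n hn).ae_dvg_eq_zero hM ?_
  have hq := (hsol.velocity n hn).isP1disc_dvg
  cases n with
  | zero => exact hdiv _ hq
  | succ n => exact hsol.integral_mul_dvg hn hq

theorem IsSolution.freeEnergy_succ_le (hsol : IsSolution D M Re Wi ε T N u p σ X)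
    (hM : IsMesh D M) (hWi : 0 < Wi) (hε : 0 ≤ ε) (hT : 0 < T)
    (hdiv : ∀ q, IsP1disc M q → ∫ x in D, q x * dvg (u 0) x = 0)
    (hpos : ∀ n ≤ N, IsPosDefField M (σ n)) {n : ℕ} (hn : n < N) :
    freeEnergy D Re Wi ε (u (n + 1)) (σ (n + 1)) - freeEnergy D Re Wi ε (u n) (σ n)
      + (∫ x in D, Re / 2 * ‖u (n + 1) x - u n x‖ ^ 2)
      + T / N * (∫ x in D, ((1 - ε) * dcontr (grad (u (n + 1)) x) (grad (u (n + 1)) x)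
        + ε / (2 * Wi ^ 2) * (σ (n + 1) x + (σ (n + 1) x)⁻¹
          - (2 : ℝ) • (1 : Matrix (Fin d) (Fin d) ℝ)).trace)) ≤ 0 := by
  have hN : (0 : ℝ) < N := Nat.cast_pos.2 (Nat.zero_lt_of_lt hn)
  have hΔt : 0 < T / N := div_pos hT hN
  have hu := hsol.velocity _ (Nat.succ_le_of_lt hn)
  have hσ := hsol.stress _ (Nat.succ_le_of_lt hn)
  have hd0 := hsol.ae_dvg_eq_zero hM hdiv hn.le
  obtain ⟨Y, hY, hXY⟩ := (hsol.flow n hn).measurePreserving (by nlinarith) hM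
    (hsol.velocity n hn.le) hd0
  refine freeEnergy_step_le hM hWi hε hΔt (hsol.velocity n hn.le) hu (hsol.stress n hn.le) hσ
    (hpos n hn.le) (hpos _ (Nat.succ_le_of_lt hn)) hY hd0
    (hsol.ae_dvg_eq_zero hM hdiv (Nat.succ_le_of_lt hn)) (p := p (n + 1)) ?_
  rw [← stepForm_congr_foot hM.isOpen.measurableSet hXY]
  exact hsol.step n hn _ _ _ hu (hsol.pressure _ (Nat.succ_le_of_lt hn)) (hσ.smul_one_sub_inv _)

theorem IsSolution.freeEnergy_succ_le_freeEnergy (hsol : IsSolution D M Re Wi ε T N u p σ X)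
    (hM : IsMesh D M) (hRe : 0 ≤ Re) (hWi : 0 < Wi) (hε₀ : 0 ≤ ε) (hε₁ : ε < 1) (hT : 0 < T)
    (hdiv : ∀ q, IsP1disc M q → ∫ x in D, q x * dvg (u 0) x = 0)
    (hpos : ∀ n ≤ N, IsPosDefField M (σ n)) {n : ℕ} (hn : n < N) :
    freeEnergy D Re Wi ε (u (n + 1)) (σ (n + 1)) ≤ freeEnergy D Re Wi ε (u n) (σ n) := by
  have h := hsol.freeEnergy_succ_le hM hWi hε₀ hT hdiv hpos hn
  have h1 : 0 ≤ ∫ x in D, Re / 2 * ‖u (n + 1) x - u n x‖ ^ 2 :=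
    integral_nonneg fun x => by positivity
  have h2 := mul_nonneg (div_nonneg hT.le (Nat.cast_nonneg N))
    (dissipation_nonneg (Wi := Wi) hM hε₀ hε₁ (u (n + 1)) (hpos _ (Nat.succ_le_of_lt hn)))
  linarith

end OldroydB
theorem mainTheorem1 (d : ℕ) (hd : d = 2 ∨ d = 3)
    (D : Set (Spc d)) (M : Geometry.SimplicialComplex ℝ (Spc d)) (hM : OldroydB.IsMesh D M)
    (Re Wi ε T : ℝ) (hRe : 0 ≤ Re) (hWi : 0 < Wi) (hε₀ : 0 ≤ ε) (hε₁ : ε < 1) (hT : 0 < T)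
    (N : ℕ) (hN : 0 < N)
    (u : ℕ → Spc d → Spc d) (p : ℕ → Spc d → ℝ)
    (σ : ℕ → Spc d → Matrix (Fin d) (Fin d) ℝ) (X : ℕ → ℝ → Spc d → Spc d)
    (hsol : OldroydB.IsSolution D M Re Wi ε T N u p σ X)
    (hdiv : ∀ q, OldroydB.IsP1disc M q → ∫ x in D, q x * OldroydB.dvg (u 0) x = 0)
    (hpos : ∀ n ≤ N, OldroydB.IsPosDefField M (σ n)) :
    (∀ n < N,
      OldroydB.freeEnergy D Re Wi ε (u (n + 1)) (σ (n + 1))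
        - OldroydB.freeEnergy D Re Wi ε (u n) (σ n)
        + (∫ x in D, Re / 2 * ‖u (n + 1) x - u n x‖ ^ 2)
        + T / N * (∫ x in D,
            ((1 - ε) * OldroydB.dcontr (OldroydB.grad (u (n + 1)) x) (OldroydB.grad (u (n + 1)) x)
              + ε / (2 * Wi ^ 2) *
                (σ (n + 1) x + (σ (n + 1) x)⁻¹ - (2 : ℝ) • (1 : Matrix (Fin d) (Fin d) ℝ)).trace))
          ≤ 0) ∧
    AntitoneOn (fun n => OldroydB.freeEnergy D Re Wi ε (u n) (σ n)) (Set.Iic N) := by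
  refine ⟨fun n hn => hsol.freeEnergy_succ_le hM hWi hε₀ hT hdiv hpos hn, ?_⟩
  intro m hm n hn hmn
  induction n, hmn using Nat.le_induction with
  | base => exact le_rfl
  | succ n hmn ih =>
    have hn' : n < N := Nat.lt_of_succ_le hn
    exact (hsol.freeEnergy_succ_le_freeEnergy hM hRe hWi hε₀ hε₁ hT hdiv hpos hn').trans
      (ih hn'.le)
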